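/- Let $\mathbb F$ be an algebraically closed field and let $q\in\mathbb F$ be nonzero and not a root of unity. Let $\triangle_q$ (the universal Askey--Wilson algebra) be the unital associative $\mathbb F$-algebra with generators $A,B,C$ and the relations stating that each of $$A+\frac{qBC-q^{-1}CB}{q^2-q^{-2}},\qquad B+\frac{qCA-q^{-1}AC}{q^2-q^{-2}},\qquad C+\frac{qAB-q^{-1}BA}{q^2-q^{-2}}$$ commutes with $A,B,C$. Let $\mathfrak H_q$ (the universal double affine Hecke algebra of type $(C_1^\vee,C_1)$) be the unital associative $\mathbb F$-algebra with generators $t_0^{\pm1},t_1^{\pm1},t_2^{\pm1},t_3^{\pm1}$ and the relations $t_it_i^{-1}=t_i^{-1}t_i=1$ and $t_i+t_i^{-1}$ is central for $i=0,1,2,3$, and $t_0t_1t_2t_3=q^{-1}$. View each $\mathfrak H_q$-module as a $\triangle_q$-module by pulling back along the $\mathbb F$-algebra homomorphism $\zeta:\triangle_q\to\mathfrak H_q$ given by $$A\mapsto t_1t_0+(t_1t_0)^{-1},\qquad B\mapsto t_3t_0+(t_3t_0)^{-1},\qquad C\mapsto t_2t_0+(t_2t_0)^{-1}.$$ Then for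 every finite-dimensional irreducible $\mathfrak H_q$-module $V$, the $\triangle_q$-module $V$ is completely reducible if and only if $t_0$ is diagonalizable on $V$. -/

import Mathlib

universe u v

/-- An endomorphism is diagonalizable if there is a basis consisting of eigenvectors. -/
def IsDiagonalizable {F : Type u} {V : Type v} [Field F] [AddCommGroup V] [Module F V]
    (f : Module.End F V) : Prop :=
  ∃ (ι : Type v) (b : Module.Basis ι F V), ∀ i, ∃ μ : F, f (b i) = μ • b i

/-- The generators `A, B, C` of the universal Askey--Wilson algebra. -/
inductive AWGen : Type
  | A
  | B
  | C

/-- The element `X + (q Y Z - q⁻¹ Z Y) / (q² - q⁻²)`. -/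
def awElt {F : Type u} {R : Type v} [Field F] [Ring R] [Algebra F R] (q : F) (X Y Z : R) : R :=
  X + (q ^ 2 - q⁻¹ ^ 2)⁻¹ • (q • (Y * Z) - q⁻¹ • (Z * Y))

/-- The defining relations of the universal Askey--Wilson algebra: each of the three elements
commutes with the generators. -/
inductive AWRel {F : Type u} [Field F] (q : F) :
    FreeAlgebra F AWGen → FreeAlgebra F AWGen → Prop
  | alpha (g : AWGen) : AWRel q
      (awElt q (FreeAlgebra.ι F AWGen.A) (FreeAlgebra.ι F AWGen.B) (FreeAlgebra.ι F AWGen.C)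
        * FreeAlgebra.ι F g)
      (FreeAlgebra.ι F g
        * awElt q (FreeAlgebra.ι F AWGen.A) (FreeAlgebra.ι F AWGen.B) (FreeAlgebra.ι F AWGen.C))
  | beta (g : AWGen) : AWRel q
      (awElt q (FreeAlgebra.ι F AWGen.B) (FreeAlgebra.ι F AWGen.C) (FreeAlgebra.ι F AWGen.A)
        * FreeAlgebra.ι F g)
      (FreeAlgebra.ι F g
        * awElt q (FreeAlgebra.ι F AWGen.B) (FreeAlgebra.ι F AWGen.C) (FreeAlgebra.ι F AWGen.A))
  | gamma (g : AWGen) : AWRel q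
      (awElt q (FreeAlgebra.ι F AWGen.C) (FreeAlgebra.ι F AWGen.A) (FreeAlgebra.ι F AWGen.B)
        * FreeAlgebra.ι F g)
      (FreeAlgebra.ι F g
        * awElt q (FreeAlgebra.ι F AWGen.C) (FreeAlgebra.ι F AWGen.A) (FreeAlgebra.ι F AWGen.B))

/-- The universal Askey--Wilson algebra `△_q`. -/
abbrev UniversalAW {F : Type u} [Field F] (q : F) : Type u := RingQuot (AWRel q)

/-- The image of a generator in `△_q`. -/
def UniversalAW.gen {F : Type u} [Field F] (q : F) (g : AWGen) : UniversalAW q :=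
  RingQuot.mkAlgHom F (AWRel q) (FreeAlgebra.ι F g)

/-- The generators `t_i` and `t_i⁻¹` (`i = 0, 1, 2, 3`) of the universal DAHA. -/
inductive DAHAGen : Type
  | t (i : Fin 4)
  | tInv (i : Fin 4)

/-- The defining relations of the universal DAHA of type `(C₁^∨, C₁)`. -/
inductive DAHARel {F : Type u} [Field F] (q : F) :
    FreeAlgebra F DAHAGen → FreeAlgebra F DAHAGen → Prop
  | mul_inv (i : Fin 4) : DAHARel q
      (FreeAlgebra.ι F (DAHAGen.t i) * FreeAlgebra.ι F (DAHAGen.tInv i)) 1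
  | inv_mul (i : Fin 4) : DAHARel q
      (FreeAlgebra.ι F (DAHAGen.tInv i) * FreeAlgebra.ι F (DAHAGen.t i)) 1
  | central (i : Fin 4) (x : FreeAlgebra F DAHAGen) : DAHARel q
      ((FreeAlgebra.ι F (DAHAGen.t i) + FreeAlgebra.ι F (DAHAGen.tInv i)) * x)
      (x * (FreeAlgebra.ι F (DAHAGen.t i) + FreeAlgebra.ι F (DAHAGen.tInv i)))
  | prod : DAHARel q
      (FreeAlgebra.ι F (DAHAGen.t 0) * FreeAlgebra.ι F (DAHAGen.t 1)
        * FreeAlgebra.ι F (DAHAGen.t 2) * FreeAlgebra.ι F (DAHAGen.t 3))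
      (algebraMap F (FreeAlgebra F DAHAGen) q⁻¹)

/-- The universal DAHA `H_q` of type `(C₁^∨, C₁)`. -/
abbrev UniversalDAHA {F : Type u} [Field F] (q : F) : Type u := RingQuot (DAHARel q)

namespace UniversalDAHA

/-- The generator `t_i` of `H_q`. -/
def t {F : Type u} [Field F] (q : F) (i : Fin 4) : UniversalDAHA q :=
  RingQuot.mkAlgHom F (DAHARel q) (FreeAlgebra.ι F (DAHAGen.t i))

/-- The generator `t_i⁻¹` of `H_q`. -/
def tInv {F : Type u} [Field F] (q : F) (i : Fin 4) : UniversalDAHA q :=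
  RingQuot.mkAlgHom F (DAHARel q) (FreeAlgebra.ι F (DAHAGen.tInv i))

theorem t_mul_tInv {F : Type u} [Field F] (q : F) (i : Fin 4) : t q i * tInv q i = 1 := by
  simpa [t, tInv] using RingQuot.mkAlgHom_rel F (DAHARel.mul_inv (q := q) i)

theorem tInv_mul_t {F : Type u} [Field F] (q : F) (i : Fin 4) : tInv q i * t q i = 1 := by
  simpa [t, tInv] using RingQuot.mkAlgHom_rel F (DAHARel.inv_mul (q := q) i)

theorem central {F : Type u} [Field F] (q : F) (i : Fin 4) (x : UniversalDAHA q) :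
    (t q i + tInv q i) * x = x * (t q i + tInv q i) := by
  obtain ⟨y, rfl⟩ := RingQuot.mkAlgHom_surjective F (DAHARel q) x
  simpa only [t, tInv, map_mul, map_add] using
    RingQuot.mkAlgHom_rel F (DAHARel.central (q := q) i y)

theorem prod_t {F : Type u} [Field F] (q : F) :
    t q 0 * t q 1 * t q 2 * t q 3 = algebraMap F (UniversalDAHA q) q⁻¹ := by
  have h := RingQuot.mkAlgHom_rel F (DAHARel.prod (q := q))
  rw [AlgHom.commutes] at h
  simpa only [t, map_mul] using h

end UniversalDAHA

/-! Verification that the images of `A, B, C` in `H_q` satisfy the relations of `△_q`. -/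

theorem AW.commute_aux {K R : Type*} [CommRing K] [Ring R] [Algebra K R] (c₀ c₁ : K)
    {t₀ t₁ s₀ s₁ : R} (a₀ : t₀ * s₀ = 1) (b₀ : s₀ * t₀ = 1)
    (e₀ : s₀ = c₀ • 1 - t₀) (e₁ : s₁ = c₁ • 1 - t₁) :
    t₀ * (t₁ * t₀ + s₀ * s₁) = (t₁ * t₀ + s₀ * s₁) * t₀ := by
  have h1 : t₀ * t₀ = c₀ • t₀ - 1 := by
    have := a₀
    rw [e₀, mul_sub, mul_smul_comm, mul_one] at this
    rw [← this]; abel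
  have h2 : t₀ * (s₀ * s₁) = s₁ := by rw [← mul_assoc, a₀, one_mul]
  have h3 : s₀ * s₁ * t₀ = c₁ • 1 - c₀ • (t₁ * t₀) + t₀ * (t₁ * t₀) := by
    rw [e₁, mul_sub, mul_smul_comm, mul_one, sub_mul, smul_mul_assoc, b₀, mul_assoc, e₀,
      sub_mul, smul_mul_assoc, one_mul]
    abel
  rw [mul_add, add_mul, h2, h3, mul_assoc t₁, h1, mul_sub, mul_smul_comm, mul_one, e₁]
  abel

theorem AW.relation_aux {K R : Type*} [CommRing K] [Ring R] [Algebra K R] (q p c₀ c₁ c₂ c₃ : K)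
    (hqp : q * p = 1) {t₀ t₁ t₂ t₃ s₀ s₁ s₂ s₃ : R}
    (a₀ : t₀ * s₀ = 1) (a₂ : t₂ * s₂ = 1) (a₃ : t₃ * s₃ = 1)
    (b₀ : s₀ * t₀ = 1) (b₁ : s₁ * t₁ = 1) (b₂ : s₂ * t₂ = 1)
    (e₀ : s₀ = c₀ • 1 - t₀) (e₁ : s₁ = c₁ • 1 - t₁)
    (e₂ : s₂ = c₂ • 1 - t₂) (e₃ : s₃ = c₃ • 1 - t₃)
    (h : t₀ * t₁ * t₂ * t₃ = p • 1) :
    (q ^ 2 - p ^ 2) • (t₁ * t₀ + s₀ * s₁)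
      + (q • ((t₃ * t₀ + s₀ * s₃) * (t₂ * t₀ + s₀ * s₂))
        - p • ((t₂ * t₀ + s₀ * s₂) * (t₃ * t₀ + s₀ * s₃)))
      = (q - p) • ((c₃ * c₂) • (1 : R) + c₁ • (q • s₀ + p • t₀)) := by
  have w1 : t₁ * t₂ = p • (s₀ * s₃) := by
    calc t₁ * t₂ = s₀ * (t₀ * t₁ * t₂ * t₃) * s₃ := by
          simp only [mul_assoc, a₃, mul_one]; rw [← mul_assoc s₀, b₀, one_mul]
      _ = _ := by rw [h]; simp
  have w2 : s₂ * s₁ = q • (t₃ * t₀) := by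
    have h' : t₁ * (t₂ * (t₃ * t₀)) = p • 1 := by
      calc t₁ * (t₂ * (t₃ * t₀)) = s₀ * (t₀ * t₁ * t₂ * t₃) * t₀ := by
            simp only [mul_assoc]; rw [← mul_assoc s₀, b₀, one_mul]
        _ = _ := by rw [h]; simp [b₀]
    calc s₂ * s₁ = (q * p) • (s₂ * s₁) := by rw [hqp, one_smul]
      _ = q • (s₂ * (s₁ * (p • 1))) := by simp [mul_smul]
      _ = _ := by
        rw [← h', ← mul_assoc s₁, b₁, one_mul, ← mul_assoc s₂, b₂, one_mul]
  have hBt := AW.commute_aux c₀ c₃ a₀ b₀ e₀ e₃ (t₁ := t₃) (s₁ := s₃)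
  set B := t₃ * t₀ + s₀ * s₃ with hB
  have hBs : B * s₀ = s₀ * B := by
    rw [e₀, mul_sub, sub_mul, hBt]; simp
  have hB' : B = q • (t₁ * t₂) + p • (s₂ * s₁) := by
    rw [w1, w2, smul_smul, smul_smul, hqp, mul_comm p, hqp, one_smul, one_smul, add_comm]
  have x1 : t₂ * B = q • (t₂ * t₁ * t₂) + p • s₁ := by
    rw [hB', mul_add, mul_smul_comm, mul_smul_comm, ← mul_assoc, ← mul_assoc, a₂, one_mul]
  have x2 : s₂ * B = c₂ • B - t₂ * B := by rw [e₂, sub_mul, smul_mul_assoc, one_mul]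
  have x3 : B * s₂ = q • t₁ + p • (s₂ * s₁ * s₂) := by
    rw [hB', add_mul, smul_mul_assoc, smul_mul_assoc, mul_assoc t₁, a₂, mul_one]
  have x4 : B * t₂ = c₂ • B - B * s₂ := by rw [e₂, mul_sub, mul_smul_comm, mul_one]; abel
  have hCB : (t₂ * t₀ + s₀ * s₂) * B = (q • (t₂ * t₁ * t₂) + p • s₁) * t₀
      + s₀ * (c₂ • B - (q • (t₂ * t₁ * t₂) + p • s₁)) := by
    rw [add_mul, mul_assoc, hBt, ← mul_assoc, x1, mul_assoc s₀, x2, x1]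
  have hBC : B * (t₂ * t₀ + s₀ * s₂) = (c₂ • B - (q • t₁ + p • (s₂ * s₁ * s₂))) * t₀
      + s₀ * (q • t₁ + p • (s₂ * s₁ * s₂)) := by
    rw [mul_add, ← mul_assoc, x4, ← mul_assoc, hBs, mul_assoc, x3]
  have sq2 : t₂ * t₂ = c₂ • t₂ - 1 := by
    have := a₂
    rw [e₂, mul_sub, mul_smul_comm, mul_one] at this
    rw [← this]; abel
  have hpq : p * q = 1 := by rw [mul_comm, hqp]
  have hZ : s₂ * s₁ * s₂ = c₂ • ((1 - q ^ 2) • (t₁ * t₂) + q • B) - c₁ • 1 - t₂ * t₁ * t₂ := by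
    have y : q • B = q ^ 2 • (t₁ * t₂) + s₂ * s₁ := by
      rw [hB', smul_add, smul_smul, smul_smul, hqp, one_smul, sq]
    rw [y, e₂, e₁]
    simp only [sub_mul, mul_sub, smul_mul_assoc, mul_smul_comm, one_mul, mul_one, sq2, mul_assoc]
    module
  have hBt0 : B * t₀ = q • (t₁ * t₂ * t₀) + p • (s₂ * s₁ * t₀) := by
    rw [hB', add_mul, smul_mul_assoc, smul_mul_assoc]
  have hsB : s₀ * B = q • (s₀ * (t₁ * t₂)) + p • (s₀ * (s₂ * s₁)) := by
    rw [hB', mul_add, mul_smul_comm, mul_smul_comm]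
  have last : p • (s₀ * (s₂ * s₁)) + q • (t₁ * t₂ * t₀) = c₃ • 1 := by
    rw [w1, w2, mul_smul_comm, smul_mul_assoc, smul_smul, smul_smul, hqp, hpq, e₃]
    simp only [sub_mul, mul_sub, smul_mul_assoc, mul_smul_comm, mul_one, mul_assoc, b₀]
    module
  have m1 : s₁ * t₀ = c₁ • t₀ - t₁ * t₀ := by rw [e₁, sub_mul, smul_mul_assoc, one_mul]
  have m2 : s₀ * s₁ = c₁ • s₀ - s₀ * t₁ := by rw [e₁, mul_sub, mul_smul_comm, mul_one]
  rw [hBC, hCB, hZ]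
  simp only [add_mul, sub_mul, mul_add, mul_sub, smul_mul_assoc, mul_smul_comm, one_mul, mul_one,
    m1, m2, hsB]
  have last2 : q • (t₁ * t₂ * t₀) = c₃ • 1 - p • (s₀ * (s₂ * s₁)) := by rw [← last]; abel
  generalize t₂ * t₁ * t₂ * t₀ = M at *
  generalize s₀ * (t₂ * t₁ * t₂) = M' at *
  generalize t₁ * t₂ * t₀ = W at *
  generalize s₀ * (t₁ * t₂) = W' at *
  generalize s₀ * (s₂ * s₁) = U at *
  generalize s₀ * t₁ = y at *
  generalize t₁ * t₀ = y' at *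
  generalize B * t₀ = z at *
  clear * - last2 hqp
  linear_combination (norm := module) (c₂ * (q - p)) • last2
    + hqp • ((c₂ * q ^ 2) • W - (c₂ * q) • z + (-c₂ * q ^ 2) • W'
      + (c₂ * q) • (q • W' + p • U))

theorem AW.commute_t0 {R : Type v} [Ring R] {t₀ t₁ s₀ s₁ : R}
    (a₀ : t₀ * s₀ = 1) (b₀ : s₀ * t₀ = 1)
    (z₀ : ∀ x, (t₀ + s₀) * x = x * (t₀ + s₀)) (z₁ : ∀ x, (t₁ + s₁) * x = x * (t₁ + s₁)) :
    t₀ * (t₁ * t₀ + s₀ * s₁) = (t₁ * t₀ + s₀ * s₁) * t₀ := by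
  let _ : Algebra (Subring.center R) R :=
    (Subring.center R).subtype.toAlgebra' fun c x => (Subring.mem_center_iff.1 c.2 x).symm
  have hc : ∀ y : R, (∀ x, y * x = x * y) → y ∈ Subring.center R :=
    fun y hy => Subring.mem_center_iff.2 fun x => (hy x).symm
  refine AW.commute_aux (K := Subring.center R) ⟨_, hc _ z₀⟩ ⟨_, hc _ z₁⟩ a₀ b₀ ?_ ?_ <;>
  · rw [Algebra.smul_def, mul_one]
    exact (add_sub_cancel_left _ _).symm

theorem AW.commute_awElt {F : Type u} {R : Type v} [Field F] [Ring R] [Algebra F R] (q : F)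
    (hq0 : q ≠ 0) (hq : ∀ n : ℕ, 0 < n → q ^ n ≠ 1) {t₀ t₁ t₂ t₃ s₀ s₁ s₂ s₃ : R}
    (a₀ : t₀ * s₀ = 1) (a₂ : t₂ * s₂ = 1) (a₃ : t₃ * s₃ = 1)
    (b₀ : s₀ * t₀ = 1) (b₁ : s₁ * t₁ = 1) (b₂ : s₂ * t₂ = 1)
    (z₀ : ∀ x, (t₀ + s₀) * x = x * (t₀ + s₀)) (z₁ : ∀ x, (t₁ + s₁) * x = x * (t₁ + s₁))
    (z₂ : ∀ x, (t₂ + s₂) * x = x * (t₂ + s₂)) (z₃ : ∀ x, (t₃ + s₃) * x = x * (t₃ + s₃))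
    (h : t₀ * t₁ * t₂ * t₃ = algebraMap F R q⁻¹) (x : R) (hx : t₀ * x = x * t₀) :
    awElt q (t₁ * t₀ + s₀ * s₁) (t₃ * t₀ + s₀ * s₃) (t₂ * t₀ + s₀ * s₂) * x
      = x * awElt q (t₁ * t₀ + s₀ * s₁) (t₃ * t₀ + s₀ * s₃) (t₂ * t₀ + s₀ * s₂) := by
  let _ : Algebra (Subring.center R) R :=
    (Subring.center R).subtype.toAlgebra' fun c x => (Subring.mem_center_iff.1 c.2 x).symm
  have hc : ∀ y : R, (∀ x, y * x = x * y) → y ∈ Subring.center R :=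
    fun y hy => Subring.mem_center_iff.2 fun x => (hy x).symm
  have hs : ∀ (y : Subring.center R) (r : R), y • r = (y : R) * r := fun y r =>
    Algebra.smul_def y r
  have key := AW.relation_aux (K := Subring.center R) (R := R)
    ⟨_, hc _ (Algebra.commutes q)⟩ ⟨_, hc _ (Algebra.commutes q⁻¹)⟩
    ⟨_, hc _ z₀⟩ ⟨_, hc _ z₁⟩ ⟨_, hc _ z₂⟩ ⟨_, hc _ z₃⟩
    (by ext; simp [← map_mul, hq0]) a₀ a₂ a₃ b₀ b₁ b₂
    (by rw [hs]; simp) (by rw [hs]; simp) (by rw [hs]; simp) (by rw [hs]; simp)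
    (by rw [hs]; simpa using h)
  simp only [hs] at key
  push_cast at key
  simp only [mul_one, ← map_pow, ← map_sub, ← Algebra.smul_def] at key
  have hd : q ^ 2 - q⁻¹ ^ 2 ≠ 0 := by
    intro h0
    apply hq 4 (by norm_num)
    field_simp at h0
    linear_combination h0
  have hE : awElt q (t₁ * t₀ + s₀ * s₁) (t₃ * t₀ + s₀ * s₃) (t₂ * t₀ + s₀ * s₂)
      = (q ^ 2 - q⁻¹ ^ 2)⁻¹ • (q - q⁻¹) • ((t₃ + s₃) * (t₂ + s₂)
        + (t₁ + s₁) * (q • s₀ + q⁻¹ • t₀)) := by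
    rw [← key, smul_add, smul_smul, inv_mul_cancel₀ hd, one_smul]
    rfl
  have hx' : Commute s₀ x := by
    show s₀ * x = x * s₀
    calc s₀ * x = s₀ * (x * t₀) * s₀ := by rw [mul_assoc, mul_assoc, a₀, mul_one]
      _ = x * s₀ := by rw [← hx, ← mul_assoc, b₀, one_mul]
  have hx0 : Commute t₀ x := hx
  have k1 : Commute (t₁ + s₁) x := z₁ x
  have k2 : Commute (t₂ + s₂) x := z₂ x
  have k3 : Commute (t₃ + s₃) x := z₃ x
  rw [hE]
  exact (((k3.mul_left k2).add_left
    (k1.mul_left ((hx'.smul_left q).add_left (hx0.smul_left q⁻¹)))).smul_left _).smul_left _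

namespace UniversalDAHA

/-- The images of the generators: `A ↦ t₁t₀ + (t₁t₀)⁻¹`, `B ↦ t₃t₀ + (t₃t₀)⁻¹`,
`C ↦ t₂t₀ + (t₂t₀)⁻¹`, where `(t_i t₀)⁻¹ = t₀⁻¹ t_i⁻¹`. -/
def zetaGen {F : Type u} [Field F] (q : F) : AWGen → UniversalDAHA q
  | AWGen.A => t q 1 * t q 0 + tInv q 0 * tInv q 1
  | AWGen.B => t q 3 * t q 0 + tInv q 0 * tInv q 3
  | AWGen.C => t q 2 * t q 0 + tInv q 0 * tInv q 2

theorem t_zero_commute_zetaGen {F : Type u} [Field F] (q : F) (g : AWGen) :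
    t q 0 * zetaGen q g = zetaGen q g * t q 0 := by
  cases g <;>
  exact AW.commute_t0 (t_mul_tInv q 0) (tInv_mul_t q 0) (central q 0) (central q _)

theorem zetaGen_conj {F : Type u} [Field F] (q : F) (i : Fin 4)
    (h : t q 0 * (t q i * t q 0 + tInv q 0 * tInv q i)
      = (t q i * t q 0 + tInv q 0 * tInv q i) * t q 0) :
    (tInv q 0 * t q i * t q 0) * t q 0 + tInv q 0 * (tInv q 0 * tInv q i * t q 0)
      = t q i * t q 0 + tInv q 0 * tInv q i := by
  calc _ = tInv q 0 * ((t q i * t q 0 + tInv q 0 * tInv q i) * t q 0) := by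
        simp only [mul_add, add_mul, mul_assoc]
    _ = _ := by rw [← h, ← mul_assoc, tInv_mul_t, one_mul]

theorem conj_central {F : Type u} [Field F] (q : F) (i : Fin 4) (x : UniversalDAHA q) :
    (tInv q 0 * t q i * t q 0 + tInv q 0 * tInv q i * t q 0) * x
      = x * (tInv q 0 * t q i * t q 0 + tInv q 0 * tInv q i * t q 0) := by
  have h : tInv q 0 * t q i * t q 0 + tInv q 0 * tInv q i * t q 0 = t q i + tInv q i := by
    rw [← add_mul, ← mul_add, ← central, mul_assoc, tInv_mul_t, mul_one]
  rw [h, central]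

theorem conj_mul {F : Type u} [Field F] (q : F) (x y : UniversalDAHA q) (h : x * y = 1) :
    (tInv q 0 * x * t q 0) * (tInv q 0 * y * t q 0) = 1 := by
  calc _ = tInv q 0 * (x * ((t q 0 * tInv q 0) * y)) * t q 0 := by simp only [mul_assoc]
    _ = 1 := by rw [t_mul_tInv, one_mul, h, mul_one, tInv_mul_t]

theorem rel_alpha {F : Type u} [Field F] (q : F) (hq0 : q ≠ 0)
    (hq : ∀ n : ℕ, 0 < n → q ^ n ≠ 1) (g : AWGen) :
    awElt q (zetaGen q AWGen.A) (zetaGen q AWGen.B) (zetaGen q AWGen.C) * zetaGen q g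
      = zetaGen q g * awElt q (zetaGen q AWGen.A) (zetaGen q AWGen.B) (zetaGen q AWGen.C) :=
  AW.commute_awElt q hq0 hq (t_mul_tInv q 0) (t_mul_tInv q 2) (t_mul_tInv q 3)
    (tInv_mul_t q 0) (tInv_mul_t q 1) (tInv_mul_t q 2)
    (central q 0) (central q 1) (central q 2) (central q 3) (prod_t q) _
    (t_zero_commute_zetaGen q g)

/-- Cyclic rotation of the last defining relation. -/
theorem prod_t_rot {F : Type u} [Field F] (q : F) :
    t q 3 * t q 0 * t q 1 * t q 2 = algebraMap F (UniversalDAHA q) q⁻¹ := by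
  calc _ = t q 3 * (t q 0 * t q 1 * t q 2 * t q 3) * tInv q 3 := by
        simp only [mul_assoc, t_mul_tInv, mul_one]
    _ = _ := by
        rw [prod_t, ← Algebra.commutes, mul_assoc, t_mul_tInv, mul_one]

theorem prod_t_rot_rot {F : Type u} [Field F] (q : F) :
    t q 2 * t q 3 * t q 0 * t q 1 = algebraMap F (UniversalDAHA q) q⁻¹ := by
  calc _ = t q 2 * (t q 3 * t q 0 * t q 1 * t q 2) * tInv q 2 := by
        simp only [mul_assoc, t_mul_tInv, mul_one]
    _ = _ := by
        rw [prod_t_rot, ← Algebra.commutes, mul_assoc, t_mul_tInv, mul_one]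

theorem rel_beta {F : Type u} [Field F] (q : F) (hq0 : q ≠ 0)
    (hq : ∀ n : ℕ, 0 < n → q ^ n ≠ 1) (g : AWGen) :
    awElt q (zetaGen q AWGen.B) (zetaGen q AWGen.C) (zetaGen q AWGen.A) * zetaGen q g
      = zetaGen q g * awElt q (zetaGen q AWGen.B) (zetaGen q AWGen.C) (zetaGen q AWGen.A) := by
  have h := AW.commute_awElt q hq0 hq (t₁ := tInv q 0 * t q 3 * t q 0)
    (s₁ := tInv q 0 * tInv q 3 * t q 0)
    (t_mul_tInv q 0) (t_mul_tInv q 1) (t_mul_tInv q 2)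
    (tInv_mul_t q 0) (conj_mul q _ _ (tInv_mul_t q 3)) (tInv_mul_t q 1)
    (central q 0) (conj_central q 3) (central q 1) (central q 2)
    (by
      rw [← prod_t_rot q]
      simp only [← mul_assoc]
      rw [t_mul_tInv, one_mul]) _ (t_zero_commute_zetaGen q g)
  rw [zetaGen_conj q 3 (t_zero_commute_zetaGen q AWGen.B)] at h
  exact h

theorem rel_gamma {F : Type u} [Field F] (q : F) (hq0 : q ≠ 0)
    (hq : ∀ n : ℕ, 0 < n → q ^ n ≠ 1) (g : AWGen) :
    awElt q (zetaGen q AWGen.C) (zetaGen q AWGen.A) (zetaGen q AWGen.B) * zetaGen q g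
      = zetaGen q g * awElt q (zetaGen q AWGen.C) (zetaGen q AWGen.A) (zetaGen q AWGen.B) := by
  have h := AW.commute_awElt q hq0 hq (t₁ := tInv q 0 * t q 2 * t q 0)
    (s₁ := tInv q 0 * tInv q 2 * t q 0) (t₂ := tInv q 0 * t q 3 * t q 0)
    (s₂ := tInv q 0 * tInv q 3 * t q 0)
    (t_mul_tInv q 0) (conj_mul q _ _ (t_mul_tInv q 3)) (t_mul_tInv q 1)
    (tInv_mul_t q 0) (conj_mul q _ _ (tInv_mul_t q 2)) (conj_mul q _ _ (tInv_mul_t q 3))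
    (central q 0) (conj_central q 2) (conj_central q 3) (central q 1)
    (by
      rw [← prod_t_rot_rot q]
      simp only [← mul_assoc]
      rw [t_mul_tInv, one_mul, mul_assoc (t q 2) (t q 0), t_mul_tInv, mul_one]) _
    (t_zero_commute_zetaGen q g)
  rw [zetaGen_conj q 2 (t_zero_commute_zetaGen q AWGen.C),
    zetaGen_conj q 3 (t_zero_commute_zetaGen q AWGen.B)] at h
  exact h

/-- The algebra homomorphism `ζ : △_q → H_q`. -/
def zeta {F : Type u} [Field F] (q : F) (hq0 : q ≠ 0) (hq : ∀ n : ℕ, 0 < n → q ^ n ≠ 1) :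
    UniversalAW q →ₐ[F] UniversalDAHA q :=
  RingQuot.liftAlgHom F ⟨FreeAlgebra.lift F (zetaGen q), by
    intro x y hxy
    cases hxy with
    | alpha g => simpa [awElt] using rel_alpha q hq0 hq g
    | beta g => simpa [awElt] using rel_beta q hq0 hq g
    | gamma g => simpa [awElt] using rel_gamma q hq0 hq g⟩

theorem zeta_gen {F : Type u} [Field F] (q : F) (hq0 : q ≠ 0)
    (hq : ∀ n : ℕ, 0 < n → q ^ n ≠ 1) (g : AWGen) :
    zeta q hq0 hq (UniversalAW.gen q g) = zetaGen q g := by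
  simp [zeta, UniversalAW.gen]

/-- The `△_q`-module structure on an `H_q`-module `V` obtained by pulling back via `ζ`. -/
abbrev pullbackModule {F : Type u} [Field F] (q : F) (hq0 : q ≠ 0)
    (hq : ∀ n : ℕ, 0 < n → q ^ n ≠ 1) (V : Type v) [AddCommGroup V]
    [Module (UniversalDAHA q) V] : Module (UniversalAW q) V :=
  Module.compHom V (zeta q hq0 hq).toRingHom

end UniversalDAHA

/-! By Schur's lemma each t_i + t_i⁻¹ acts on V as a scalar c_i. Everything is then linear algebra
with four operators T_i satisfying T_i² - c_i T_i + 1 = 0 and T₀T₁T₂T₃ = q⁻¹, and with the operators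
X_i = T_iT₀ + (T_iT₀)⁻¹ for i = 1, 2, 3, which commute with T₀. Write c₀ = k + k' with kk' = 1, so
that (T₀ - k)(T₀ - k') = 0.

If k ≠ k', then T₀ is diagonalizable and both of its eigenspaces are stable under the X_i. Each is
zero or irreducible (`eigenspace_irreducible`): for a stable W in the k-eigenspace, the sum of the
T_i W is an H_q-submodule that T₀ - k' maps into W. If this sum is V, then W contains (k - k') times
the k-eigenspace. So V is a sum of at most two simple modules, and both sides of the equivalence
hold.

If k = k', then k² = 1 and (T₀ - k)² = 0. If T₀ is diagonalizable, it is the scalar k, the X_i are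
scalars too, and every subspace is a submodule. Conversely, a determinant count shows that some c_i
with i ≠ 0 is nonzero (`exists_ne_zero`), and the Askey–Wilson relation of that index expresses T₀
through the X_i (`zero_apply_mem`). A stable complement Q of the k-eigenspace is then T₀-stable, and
T₀ - k maps it into its intersection with that eigenspace, which is zero. So Q lies in the
eigenspace and T₀ = k. -/

/-- Ring elements `T i` with inverses `S i = c i - T i` and `T₀T₁T₂T₃ = q⁻¹`. -/
structure IsDAHASystem {F : Type*} {R : Type*} [Field F] [Ring R] [Algebra F R] (q : F)
    (c : Fin 4 → F) (T S : Fin 4 → R) : Prop where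
  mul_inv : ∀ i, T i * S i = 1
  inv_mul : ∀ i, S i * T i = 1
  inv_eq : ∀ i, S i = c i • 1 - T i
  prod : T 0 * T 1 * T 2 * T 3 = q⁻¹ • (1 : R)

/-- The element `T i T₀ + (T i T₀)⁻¹`. -/
def dahaX {R : Type*} [Ring R] (T S : Fin 4 → R) (i : Fin 4) : R :=
  T i * T 0 + S 0 * S i

namespace IsDAHASystem

/-! ### Ring identities: cyclic forms of the product relation and the Askey–Wilson relations. -/

section Ring

variable {F R : Type*} [Field F] [Ring R] [Algebra F R] {q : F} {c : Fin 4 → F} {T S : Fin 4 → R}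

theorem cancel_left (h : IsDAHASystem q c T S) (i : Fin 4) (x : R) : S i * (T i * x) = x := by
  rw [← mul_assoc, h.inv_mul, one_mul]

theorem cancel_left' (h : IsDAHASystem q c T S) (i : Fin 4) (x : R) : T i * (S i * x) = x := by
  rw [← mul_assoc, h.mul_inv, one_mul]

theorem zero_mul_one (h : IsDAHASystem q c T S) : T 0 * T 1 = q⁻¹ • (S 3 * S 2) := by
  calc T 0 * T 1 = T 0 * T 1 * T 2 * T 3 * S 3 * S 2 := by
        simp only [mul_assoc, h.mul_inv, mul_one]
    _ = _ := by rw [h.prod]; simp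

theorem one_mul_two (h : IsDAHASystem q c T S) : T 1 * T 2 = q⁻¹ • (S 0 * S 3) := by
  calc T 1 * T 2 = S 0 * (T 0 * T 1 * T 2 * T 3) * S 3 := by
        simp only [mul_assoc, h.cancel_left, h.mul_inv, mul_one]
    _ = _ := by rw [h.prod]; simp

theorem two_mul_three (h : IsDAHASystem q c T S) : T 2 * T 3 = q⁻¹ • (S 1 * S 0) := by
  calc T 2 * T 3 = S 1 * (S 0 * (T 0 * T 1 * T 2 * T 3)) := by
        simp only [mul_assoc, h.cancel_left]
    _ = _ := by rw [h.prod]; simp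

theorem three_mul_zero_mul_one (h : IsDAHASystem q c T S) :
    T 3 * T 0 * T 1 = q⁻¹ • S 2 := by
  calc T 3 * T 0 * T 1 = T 3 * (T 0 * T 1 * T 2 * T 3) * S 3 * S 2 := by
        simp only [mul_assoc, h.mul_inv, mul_one]
    _ = _ := by
        rw [h.prod, mul_smul_comm, mul_one, smul_mul_assoc, h.mul_inv, smul_mul_assoc, one_mul]

/-- The inverse of the product relation. -/
theorem prod_inv (h : IsDAHASystem q c T S) (hq0 : q ≠ 0) :
    S 3 * S 2 * S 1 * S 0 = q • (1 : R) := by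
  have : S 3 * S 2 * S 1 * S 0 * (T 0 * T 1 * T 2 * T 3) = 1 := by
    simp only [mul_assoc, h.cancel_left, h.inv_mul]
  rw [h.prod, mul_smul_comm, mul_one] at this
  rw [← this, smul_smul, mul_inv_cancel₀ hq0, one_smul]

theorem inv_three_mul_inv_two (h : IsDAHASystem q c T S) (hq0 : q ≠ 0) :
    S 3 * S 2 = q • (T 0 * T 1) := by
  rw [h.zero_mul_one, smul_smul, mul_inv_cancel₀ hq0, one_smul]

theorem inv_two_mul_inv_one (h : IsDAHASystem q c T S) (hq0 : q ≠ 0) :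
    S 2 * S 1 = q • (T 3 * T 0) := by
  calc S 2 * S 1 = T 3 * (S 3 * S 2 * S 1 * S 0) * T 0 := by
        simp only [mul_assoc, h.cancel_left', h.inv_mul, mul_one]
    _ = _ := by rw [h.prod_inv hq0]; simp

theorem inv_one_mul_inv_zero_mul_inv_three (h : IsDAHASystem q c T S) (hq0 : q ≠ 0) :
    S 1 * S 0 * S 3 = q • T 2 := by
  calc S 1 * S 0 * S 3 = T 2 * (T 3 * (S 3 * S 2 * S 1 * S 0) * S 3) := by
        simp only [mul_assoc, h.cancel_left']
    _ = _ := by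
        rw [h.prod_inv hq0, mul_smul_comm, mul_one, smul_mul_assoc, h.mul_inv, mul_smul_comm,
          mul_one]

theorem sq_eq (h : IsDAHASystem q c T S) (i : Fin 4) : T i * T i = c i • T i - 1 := by
  have := h.mul_inv i
  rw [h.inv_eq, mul_sub, mul_smul_comm, mul_one] at this
  rw [← this]; abel

/-- `T₀` and `T i` anticommute up to lower terms. -/
theorem zero_mul (h : IsDAHASystem q c T S) (i : Fin 4) :
    T 0 * T i = dahaX T S i - (c 0 * c i) • 1 + c 0 • T i + c i • T 0 - T i * T 0 := by
  rw [dahaX, h.inv_eq 0, h.inv_eq i]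
  simp only [sub_mul, mul_sub, smul_mul_assoc, mul_smul_comm, one_mul, mul_one]
  module

theorem commute_dahaX (h : IsDAHASystem q c T S) (i : Fin 4) :
    T 0 * dahaX T S i = dahaX T S i * T 0 :=
  AW.commute_aux (c 0) (c i) (h.mul_inv 0) (h.inv_mul 0) (h.inv_eq 0) (h.inv_eq i)

theorem conj_inv_eq (h : IsDAHASystem q c T S) (i : Fin 4) :
    S 0 * S i * T 0 = c i • 1 - S 0 * T i * T 0 := by
  rw [h.inv_eq i, mul_sub, sub_mul, mul_smul_comm, mul_one, smul_mul_assoc, h.inv_mul]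

theorem conj_mul_inv (h : IsDAHASystem q c T S) (i : Fin 4) :
    S 0 * T i * T 0 * (S 0 * S i * T 0) = 1 := by
  simp only [mul_assoc, h.cancel_left', h.inv_mul]

theorem conj_inv_mul (h : IsDAHASystem q c T S) (i : Fin 4) :
    S 0 * S i * T 0 * (S 0 * T i * T 0) = 1 := by
  simp only [mul_assoc, h.cancel_left', h.cancel_left, h.inv_mul]

/-- Since `dahaX T S i` commutes with `T 0`, conjugating `T i` by `T 0` leaves it unchanged. This
lets the remaining two relations be read off from `AW.relation_aux` after cyclically rotating the
product relation. -/
theorem conj_dahaX (h : IsDAHASystem q c T S) (i : Fin 4) :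
    S 0 * T i * T 0 * T 0 + S 0 * (S 0 * S i * T 0) = dahaX T S i := by
  calc _ = S 0 * (dahaX T S i * T 0) := by
        simp only [dahaX, mul_add, add_mul, mul_assoc]
    _ = _ := by rw [← h.commute_dahaX, h.cancel_left]

/-- The right side is the point of this relation and its two rotations: it is affine in `T 0`, so
when `c 1 ≠ 0` it can be solved for `T 0`. -/
theorem relation_one (h : IsDAHASystem q c T S) (hq0 : q ≠ 0) :
    (q ^ 2 - q⁻¹ ^ 2) • dahaX T S 1 + (q • (dahaX T S 3 * dahaX T S 2)
      - q⁻¹ • (dahaX T S 2 * dahaX T S 3))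
      = (q - q⁻¹) • ((c 3 * c 2) • (1 : R) + c 1 • (q • S 0 + q⁻¹ • T 0)) :=
  AW.relation_aux q q⁻¹ (c 0) (c 1) (c 2) (c 3) (mul_inv_cancel₀ hq0)
    (h.mul_inv 0) (h.mul_inv 2) (h.mul_inv 3) (h.inv_mul 0) (h.inv_mul 1) (h.inv_mul 2)
    (h.inv_eq 0) (h.inv_eq 1) (h.inv_eq 2) (h.inv_eq 3) h.prod

theorem relation_three (h : IsDAHASystem q c T S) (hq0 : q ≠ 0) :
    (q ^ 2 - q⁻¹ ^ 2) • dahaX T S 3 + (q • (dahaX T S 2 * dahaX T S 1)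
      - q⁻¹ • (dahaX T S 1 * dahaX T S 2))
      = (q - q⁻¹) • ((c 2 * c 1) • (1 : R) + c 3 • (q • S 0 + q⁻¹ • T 0)) := by
  -- The rotated quadruple is T₀, T₀⁻¹T₃T₀, T₁, T₂, whose product is T₃T₀T₁T₂ = q⁻¹.
  have key := AW.relation_aux q q⁻¹ (c 0) (c 3) (c 1) (c 2) (mul_inv_cancel₀ hq0)
    (h.mul_inv 0) (h.mul_inv 1) (h.mul_inv 2) (h.inv_mul 0) (h.conj_inv_mul 3) (h.inv_mul 1)
    (h.inv_eq 0) (h.conj_inv_eq 3) (h.inv_eq 1) (h.inv_eq 2) (by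
      simp only [mul_assoc, h.cancel_left']
      rw [h.one_mul_two, ← mul_assoc, mul_smul_comm]
      simp only [mul_assoc, h.cancel_left', h.mul_inv])
  rw [h.conj_dahaX] at key
  exact key

theorem relation_two (h : IsDAHASystem q c T S) (hq0 : q ≠ 0) :
    (q ^ 2 - q⁻¹ ^ 2) • dahaX T S 2 + (q • (dahaX T S 1 * dahaX T S 3)
      - q⁻¹ • (dahaX T S 3 * dahaX T S 1))
      = (q - q⁻¹) • ((c 1 * c 3) • (1 : R) + c 2 • (q • S 0 + q⁻¹ • T 0)) := by
  -- The rotated quadruple is T₀, T₀⁻¹T₂T₀, T₀⁻¹T₃T₀, T₁, whose product is T₂T₃T₀T₁ = q⁻¹.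
  have key := AW.relation_aux q q⁻¹ (c 0) (c 2) (c 3) (c 1) (mul_inv_cancel₀ hq0)
    (h.mul_inv 0) (h.conj_mul_inv 3) (h.mul_inv 1) (h.inv_mul 0) (h.conj_inv_mul 2)
    (h.conj_inv_mul 3) (h.inv_eq 0) (h.conj_inv_eq 2) (h.conj_inv_eq 3) (h.inv_eq 1) (by
      simp only [mul_assoc, h.cancel_left']
      rw [← mul_assoc (T 3), h.three_mul_zero_mul_one, mul_smul_comm, h.mul_inv])
  rw [h.conj_dahaX, h.conj_dahaX] at key
  exact key

end Ring

/-! ### Irreducibility of the eigenspaces of T₀. -/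

section Module

variable {F V : Type*} [Field F] [AddCommGroup V] [Module F V] {q : F} {c : Fin 4 → F}
  {T S : Fin 4 → Module.End F V}

theorem inv_apply (h : IsDAHASystem q c T S) (i : Fin 4) (v : V) : S i v = c i • v - T i v := by
  rw [h.inv_eq]; simp

theorem inv_apply_mem_iff (h : IsDAHASystem q c T S) {P : Submodule F V} {v : V} (i : Fin 4)
    (hv : v ∈ P) : S i v ∈ P ↔ T i v ∈ P := by
  rw [h.inv_apply]
  exact P.sub_mem_iff_right (P.smul_mem _ hv)

theorem apply_apply_mem (h : IsDAHASystem q c T S) {P : Submodule F V} {v : V} (i : Fin 4)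
    (hv : v ∈ P) (hT : T i v ∈ P) : T i (T i v) ∈ P := by
  have := LinearMap.congr_fun (h.sq_eq i) v
  simp only [Module.End.mul_apply, LinearMap.sub_apply, LinearMap.smul_apply,
    Module.End.one_apply] at this
  rw [this]
  exact P.sub_mem (P.smul_mem _ hT) hv

/-- On a `k`-eigenvector `w` the commutation rule `zero_mul` makes `T 0 - k'` send `T i w` to an
expression in `dahaX T S i w` and `w` alone, hence back into any stable subspace containing `w`. -/
theorem zero_apply_of_eigen (h : IsDAHASystem q c T S) {k k' : F} (hc : c 0 = k + k')
    {w : V} (hw : T 0 w = k • w) (i : Fin 4) :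
    T 0 (T i w) = (dahaX T S i w - (k' * c i) • w) + k' • T i w := by
  have := LinearMap.congr_fun (h.zero_mul i) w
  simp only [Module.End.mul_apply, LinearMap.sub_apply, LinearMap.smul_apply, LinearMap.add_apply,
    Module.End.one_apply, hw, map_smul, hc] at this
  rw [this]
  module

/-- A subspace of the `k`-eigenspace of `T₀` that is stable under the Askey--Wilson generators is
zero or the whole eigenspace. -/
theorem eigenspace_irreducible (h : IsDAHASystem q c T S) (hq0 : q ≠ 0)
    (irr : ∀ P : Submodule F V, (∀ i, ∀ v ∈ P, T i v ∈ P) → P = ⊥ ∨ P = ⊤)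
    {k k' : F} (hkk : k * k' = 1) (hc : c 0 = k + k') (hne : k ≠ k') (W : Submodule F V)
    (hW : W ≤ Module.End.eigenspace (T 0) k)
    (hX : ∀ i, i ≠ 0 → ∀ w ∈ W, dahaX T S i w ∈ W) :
    W = ⊥ ∨ W = Module.End.eigenspace (T 0) k := by
  have hk : k ≠ 0 := left_ne_zero_of_mul_eq_one hkk
  have hk' : k' ≠ 0 := right_ne_zero_of_mul_eq_one hkk
  have hqi : q⁻¹ ≠ 0 := inv_ne_zero hq0
  have hT0 : ∀ w ∈ W, T 0 w = k • w := fun w hw => Module.End.mem_eigenspace_iff.1 (hW hw)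
  have hS0 : ∀ w ∈ W, S 0 w = k' • w := fun w hw => by
    rw [h.inv_apply, hT0 w hw, hc]; module
  have hY : ∀ i, i ≠ 0 → ∀ w ∈ W, dahaX T S i w - (k' * c i) • w ∈ W := fun i hi w hw =>
    W.sub_mem (hX i hi w hw) (W.smul_mem _ hw)
  -- The index 0 contributes W itself, as T₀ is the nonzero scalar k there. The aim is that every
  -- T_i T_j W lies in M: cyclically adjacent pairs reduce through the product relation to shorter
  -- words or to words starting or ending with T₀.
  let M : Submodule F V := ⨆ i, W.map (T i)
  have hTM : ∀ i, ∀ w ∈ W, T i w ∈ M := fun i w hw =>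
    Submodule.mem_iSup_of_mem i (Submodule.mem_map_of_mem hw)
  have hWM : ∀ w ∈ W, w ∈ M := fun w hw => by
    have := hTM 0 w hw
    rw [hT0 w hw] at this
    exact (M.smul_mem_iff hk).1 this
  have hSM : ∀ i, ∀ w ∈ W, S i w ∈ M := fun i w hw =>
    (h.inv_apply_mem_iff i (hWM w hw)).2 (hTM i w hw)
  have h0M : ∀ i, ∀ w ∈ W, T 0 (T i w) ∈ M := by
    intro i w hw
    by_cases hi : i = 0
    · subst hi
      exact h.apply_apply_mem 0 (hWM w hw) (hTM 0 w hw)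
    · rw [h.zero_apply_of_eigen hc (hT0 w hw)]
      exact M.add_mem (hWM _ (hY i hi w hw)) (M.smul_mem _ (hTM i w hw))
  have hi0 : ∀ i, ∀ w ∈ W, T i (T 0 w) ∈ M := fun i w hw => by
    rw [hT0 w hw, map_smul]; exact M.smul_mem _ (hTM i w hw)
  have h12 : ∀ w ∈ W, T 1 (T 2 w) ∈ M := fun w hw => by
    have e : T 1 (T 2 w) = q⁻¹ • S 0 (S 3 w) := LinearMap.congr_fun h.one_mul_two w
    rw [e]
    refine M.smul_mem _ ((h.inv_apply_mem_iff 0 (hSM 3 w hw)).2 ?_)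
    rw [h.inv_apply 3, map_sub, map_smul]
    exact M.sub_mem (M.smul_mem _ (hTM 0 w hw)) (h0M 3 w hw)
  have h23 : ∀ w ∈ W, T 2 (T 3 w) ∈ M := fun w hw => by
    have e : T 2 (T 3 w) = q⁻¹ • S 1 (S 0 w) := LinearMap.congr_fun h.two_mul_three w
    rw [e, hS0 w hw, map_smul]
    exact M.smul_mem _ (M.smul_mem _ (hSM 1 w hw))
  have hSS : ∀ i j, ∀ w ∈ W, S i (S j w) ∈ M → T i (T j w) ∈ M := fun i j w hw hm => by
    rw [h.inv_apply_mem_iff i (hSM j w hw), h.inv_apply j, map_sub, map_smul] at hm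
    exact (M.sub_mem_iff_right (M.smul_mem _ (hTM i w hw))).1 hm
  have h21 : ∀ w ∈ W, T 2 (T 1 w) ∈ M := fun w hw => by
    have e : S 2 (S 1 w) = q • T 3 (T 0 w) := LinearMap.congr_fun (h.inv_two_mul_inv_one hq0) w
    exact hSS 2 1 w hw (e ▸ M.smul_mem _ (hi0 3 w hw))
  have h32 : ∀ w ∈ W, T 3 (T 2 w) ∈ M := fun w hw => by
    have e : S 3 (S 2 w) = q • T 0 (T 1 w) :=
      LinearMap.congr_fun (h.inv_three_mul_inv_two hq0) w
    exact hSS 3 2 w hw (e ▸ M.smul_mem _ (h0M 1 w hw))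
  -- For the nonadjacent indices 1 and 3, use a three-letter form of the product relation and
  -- eliminate the middle T₀ by the eigenvector formula. The wanted word remains, with the nonzero
  -- coefficient k'.
  have h31 : ∀ w ∈ W, T 3 (T 1 w) ∈ M := fun w hw => by
    have e : T 3 (T 0 (T 1 w)) = q⁻¹ • S 2 w := LinearMap.congr_fun h.three_mul_zero_mul_one w
    rw [h.zero_apply_of_eigen hc (hT0 w hw), map_add, map_smul] at e
    have hm : T 3 (dahaX T S 1 w - (k' * c 1) • w) + k' • T 3 (T 1 w) ∈ M := by
      rw [e]; exact M.smul_mem _ (hSM 2 w hw)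
    exact (M.smul_mem_iff hk').1
      ((M.add_mem_iff_right (hTM 3 _ (hY 1 (by decide) w hw))).1 hm)
  have h13 : ∀ w ∈ W, T 1 (T 3 w) ∈ M := fun w hw => by
    have e : S 1 (S 0 (S 3 w)) = q • T 2 w :=
      LinearMap.congr_fun (h.inv_one_mul_inv_zero_mul_inv_three hq0) w
    have e' : S 0 (S 3 w) = ((c 3 * k') • w + (dahaX T S 3 w - (k' * c 3) • w)) - k • T 3 w := by
      rw [h.inv_apply 3, map_sub, map_smul, hS0 w hw, h.inv_apply 0,
        h.zero_apply_of_eigen hc (hT0 w hw), hc]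
      module
    have hm : S 1 (S 0 (S 3 w)) ∈ M := by rw [e]; exact M.smul_mem _ (hTM 2 w hw)
    rw [e', map_sub, map_smul] at hm
    have hm' := (M.sub_mem_iff_right
      (hSM 1 _ (W.add_mem (W.smul_mem _ hw) (hY 3 (by decide) w hw)))).1 hm
    exact (h.inv_apply_mem_iff 1 (hTM 3 w hw)).1 ((M.smul_mem_iff hk).1 hm')
  have hTT : ∀ i j, ∀ w ∈ W, T i (T j w) ∈ M := by
    intro i j w hw
    by_cases hij : i = j
    · subst hij
      exact h.apply_apply_mem i (hWM w hw) (hTM i w hw)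
    · fin_cases i <;> fin_cases j <;> first
        | exact absurd rfl hij
        | exact h0M _ w hw
        | exact hi0 _ w hw
        | exact h12 w hw
        | exact h13 w hw
        | exact h21 w hw
        | exact h23 w hw
        | exact h31 w hw
        | exact h32 w hw
  have hM : ∀ i, ∀ v ∈ M, T i v ∈ M := by
    intro i v hv
    have : M ≤ M.comap (T i) := iSup_le fun j => by
      rintro _ ⟨w, hw, rfl⟩
      exact hTT i j w hw
    exact this hv
  rcases irr M hM with h0 | h1
  · left
    rw [eq_bot_iff, ← h0]
    exact fun w hw => hWM w hw
  · right
    refine le_antisymm hW fun v hv => ?_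
    -- T₀ - k' maps M into W but acts on the k-eigenspace as the nonzero scalar k - k'; with M = V
    -- this forces W to be the whole eigenspace.
    have hle : M ≤ W.comap (T 0 - k' • 1) := iSup_le fun j => by
      rintro _ ⟨w, hw, rfl⟩
      show T 0 (T j w) - k' • T j w ∈ W
      by_cases hj : j = 0
      · subst hj
        rw [hT0 w hw, map_smul, hT0 w hw]
        exact W.sub_mem (W.smul_mem _ (W.smul_mem _ hw)) (W.smul_mem _ (W.smul_mem _ hw))
      · rw [h.zero_apply_of_eigen hc (hT0 w hw), add_sub_cancel_right]
        exact hY j hj w hw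
    have hv1 : v ∈ M := h1 ▸ Submodule.mem_top
    have hv2 : T 0 v - k' • v ∈ W := hle hv1
    rw [Module.End.mem_eigenspace_iff.1 hv, ← sub_smul] at hv2
    exact (W.smul_mem_iff (sub_ne_zero.2 hne)).1 hv2

end Module

end IsDAHASystem


/-! ### Complete reducibility against diagonalizability: distinct roots, then a double root. -/

theorem IsAlgClosed.exists_mul_eq_one_add_eq {F : Type*} [Field F] [IsAlgClosed F] (x : F) :
    ∃ k k' : F, k * k' = 1 ∧ x = k + k' := by
  obtain ⟨k, hk⟩ := IsAlgClosed.exists_root (Polynomial.X ^ 2 - Polynomial.C x * Polynomial.X + 1)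
    (by
      have : (Polynomial.X ^ 2 - Polynomial.C x * Polynomial.X + 1 : Polynomial F).degree = 2 := by
        compute_degree!
      rw [this]; decide)
  simp only [Polynomial.IsRoot, Polynomial.eval_add, Polynomial.eval_sub, Polynomial.eval_pow,
    Polynomial.eval_X, Polynomial.eval_mul, Polynomial.eval_C, Polynomial.eval_one] at hk
  exact ⟨k, x - k, by linear_combination -hk, by ring⟩

theorem isDiagonalizable_of_span {F V : Type*} [Field F] [AddCommGroup V] [Module F V]
    (f : Module.End F V) (h : ⊤ ≤ Submodule.span F {v : V | ∃ μ : F, f v = μ • v}) :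
    IsDiagonalizable f :=
  ⟨_, Module.Basis.ofSpan h, fun i => Module.Basis.ofSpan_subset h ⟨i, rfl⟩⟩

namespace IsDAHASystem

variable {F V : Type*} [Field F] [AddCommGroup V] [Module F V] {q : F} {c : Fin 4 → F}
  {T S : Fin 4 → Module.End F V}

/-- This is (T₀ - k)(T₀ - k') = 0, the factored quadratic relation. -/
theorem sub_apply_sub_apply (h : IsDAHASystem q c T S) {k k' : F} (hkk : k * k' = 1)
    (hc : c 0 = k + k') (v : V) : T 0 (T 0 v - k' • v) = k • (T 0 v - k' • v) := by
  have := LinearMap.congr_fun (h.sq_eq 0) v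
  simp only [Module.End.mul_apply, LinearMap.sub_apply, LinearMap.smul_apply,
    Module.End.one_apply, hc] at this
  rw [map_sub, map_smul, this, smul_sub, smul_smul, hkk]
  module

/-- The two eigenspaces of `T₀` span when the roots are distinct. -/
theorem eigenspace_sup (h : IsDAHASystem q c T S) {k k' : F} (hkk : k * k' = 1)
    (hc : c 0 = k + k') (hne : k ≠ k') :
    Module.End.eigenspace (T 0) k ⊔ Module.End.eigenspace (T 0) k' = ⊤ := by
  refine eq_top_iff.2 fun v _ => ?_
  have hd : k - k' ≠ 0 := sub_ne_zero.2 hne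
  have e : v = (k - k')⁻¹ • (T 0 v - k' • v) + (-(k - k')⁻¹) • (T 0 v - k • v) := by
    have : v = ((k - k')⁻¹ * (k - k')) • v := by rw [inv_mul_cancel₀ hd, one_smul]
    nth_rw 1 [this]
    module
  rw [e]
  refine Submodule.add_mem_sup (Submodule.smul_mem _ _ ?_) (Submodule.smul_mem _ _ ?_)
  · exact Module.End.mem_eigenspace_iff.2 (h.sub_apply_sub_apply hkk hc v)
  · exact Module.End.mem_eigenspace_iff.2
      (h.sub_apply_sub_apply (mul_comm k k' ▸ hkk) (add_comm k k' ▸ hc) v)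

theorem isDiagonalizable_of_ne (h : IsDAHASystem q c T S) {k k' : F} (hkk : k * k' = 1)
    (hc : c 0 = k + k') (hne : k ≠ k') : IsDiagonalizable (T 0) := by
  apply isDiagonalizable_of_span
  rw [← h.eigenspace_sup hkk hc hne]
  refine sup_le ?_ ?_ <;>
  exact fun v hv => Submodule.subset_span ⟨_, Module.End.mem_eigenspace_iff.1 hv⟩

/-- A complement of a subspace stable under the Askey--Wilson generators. -/
theorem exists_isCompl_of_ne (h : IsDAHASystem q c T S) (hq0 : q ≠ 0)
    (irr : ∀ P : Submodule F V, (∀ i, ∀ v ∈ P, T i v ∈ P) → P = ⊥ ∨ P = ⊤)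
    {k k' : F} (hkk : k * k' = 1) (hc : c 0 = k + k') (hne : k ≠ k') (P : Submodule F V)
    (hP : ∀ i, i ≠ 0 → ∀ v ∈ P, dahaX T S i v ∈ P) :
    ∃ Q : Submodule F V, (∀ i, i ≠ 0 → ∀ v ∈ Q, dahaX T S i v ∈ Q) ∧ IsCompl P Q := by
  have hE : ∀ l : F, ∀ i, i ≠ 0 → ∀ v ∈ Module.End.eigenspace (T 0) l,
      dahaX T S i v ∈ Module.End.eigenspace (T 0) l := by
    intro l i _ v hv
    rw [Module.End.mem_eigenspace_iff] at hv ⊢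
    have : T 0 (dahaX T S i v) = dahaX T S i (T 0 v) := LinearMap.congr_fun (h.commute_dahaX i) v
    rw [this, hv, map_smul]
  have hsup := h.eigenspace_sup hkk hc hne
  have hdisj : Module.End.eigenspace (T 0) k ⊓ Module.End.eigenspace (T 0) k' = ⊥ :=
    ((Module.End.eigenspaces_iSupIndep (T 0)).pairwiseDisjoint hne).eq_bot
  have irr₀ := h.eigenspace_irreducible hq0 irr hkk hc hne
  have irr₁ := h.eigenspace_irreducible hq0 irr (mul_comm k k' ▸ hkk) (add_comm k k' ▸ hc)
    hne.symm
  have hE₀ := hE k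
  have hE₁ := hE k'
  generalize Module.End.eigenspace (T 0) k = E₀ at *
  generalize Module.End.eigenspace (T 0) k' = E₁ at *
  have inf_stable : ∀ {X Y : Submodule F V}, (∀ i, i ≠ 0 → ∀ v ∈ X, dahaX T S i v ∈ X) →
      (∀ i, i ≠ 0 → ∀ v ∈ Y, dahaX T S i v ∈ Y) →
      ∀ i, i ≠ 0 → ∀ v ∈ X ⊓ Y, dahaX T S i v ∈ X ⊓ Y :=
    fun hX hY i hi v hv => ⟨hX i hi v hv.1, hY i hi v hv.2⟩
  have sup_stable : ∀ {X Y : Submodule F V}, (∀ i, i ≠ 0 → ∀ v ∈ X, dahaX T S i v ∈ X) →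
      (∀ i, i ≠ 0 → ∀ v ∈ Y, dahaX T S i v ∈ Y) →
      ∀ i, i ≠ 0 → ∀ v ∈ X ⊔ Y, dahaX T S i v ∈ X ⊔ Y := by
    intro X Y hX hY i hi v hv
    obtain ⟨x, hx, y, hy, rfl⟩ := Submodule.mem_sup.1 hv
    rw [map_add]
    exact Submodule.add_mem_sup (hX i hi x hx) (hY i hi y hy)
  -- By the modular law, a stable subspace containing E₀ is determined by its intersection with E₁,
  -- which is zero or E₁. Applied to P and to P ⊔ E₀, this leaves 0, V, E₀ or E₁ as the complement.
  have modular : ∀ X : Submodule F V, E₀ ≤ X → X = E₀ ⊔ X ⊓ E₁ := fun X hX => by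
    rw [inf_comm, ← sup_inf_assoc_of_le E₁ hX, hsup, top_inf_eq]
  rcases irr₀ (P ⊓ E₀) inf_le_right (inf_stable hP hE₀) with h0 | h0
  · rcases irr₁ ((P ⊔ E₀) ⊓ E₁) inf_le_right (inf_stable (sup_stable hP hE₀) hE₁) with h1 | h1
    · have hPE : P ≤ E₀ := by
        have := modular (P ⊔ E₀) le_sup_right
        rw [h1, sup_bot_eq] at this
        exact sup_eq_right.1 this
      rw [inf_eq_left.2 hPE] at h0
      exact ⟨⊤, fun _ _ _ _ => Submodule.mem_top, h0 ▸ isCompl_bot_top⟩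
    · refine ⟨E₀, hE₀, disjoint_iff.2 h0, codisjoint_iff.2 ?_⟩
      rw [modular (P ⊔ E₀) le_sup_right, h1, hsup]
  · have hPE : E₀ ≤ P := inf_eq_right.1 h0
    have hm := modular P hPE
    rcases irr₁ (P ⊓ E₁) inf_le_right (inf_stable hP hE₁) with h1 | h1
    · refine ⟨E₁, hE₁, disjoint_iff.2 h1, codisjoint_iff.2 ?_⟩
      rw [hm, h1, sup_bot_eq, hsup]
    · rw [h1, hsup] at hm
      exact ⟨⊥, fun i _ v hv => by
        rw [(Submodule.mem_bot F).1 hv, map_zero]; exact Submodule.zero_mem _, hm ▸ isCompl_top_bot⟩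

/-- Since (T₀ - k)² = 0, every vector of an eigenbasis has eigenvalue k. -/
theorem eq_smul_one_of_isDiagonalizable (h : IsDAHASystem q c T S) {k : F} (hkk : k * k = 1)
    (hc : c 0 = k + k) (hd : IsDiagonalizable (T 0)) : T 0 = k • 1 := by
  obtain ⟨ι, b, hb⟩ := hd
  refine b.ext fun i => ?_
  obtain ⟨μ, hμ⟩ := hb i
  have := h.sub_apply_sub_apply hkk hc (b i)
  rw [hμ, ← sub_smul, map_smul, hμ, smul_smul, smul_smul] at this
  have h2 : (μ - k) * μ = k * (μ - k) := by
    by_contra hne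
    have h3 : ((μ - k) * μ - k * (μ - k)) • b i = 0 := by rw [sub_smul, this, sub_self]
    exact b.ne_zero i ((smul_eq_zero.1 h3).resolve_left (sub_ne_zero.2 hne))
  have h4 : (μ - k) ^ 2 = 0 := by linear_combination h2
  rw [hμ, sub_eq_zero.1 (pow_eq_zero_iff two_ne_zero |>.1 h4)]
  rfl

/-- If `T₀` is a scalar then so are the Askey--Wilson generators. -/
theorem dahaX_of_eq_smul_one (h : IsDAHASystem q c T S) {k : F}
    (hc : c 0 = k + k) (hT : T 0 = k • 1) (i : Fin 4) : dahaX T S i = (k * c i) • 1 := by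
  rw [dahaX, h.inv_eq 0, h.inv_eq i, hT, hc]
  simp only [sub_mul, mul_sub, smul_mul_assoc, mul_smul_comm, one_mul, mul_one]
  module

theorem det_pow_four (h : IsDAHASystem q c T S) {i : Fin 4} (hc : c i = 0) :
    LinearMap.det (T i) ^ 4 = 1 := by
  have h2 : T i * T i = (-1 : F) • 1 := by rw [h.sq_eq, hc]; module
  have := congrArg LinearMap.det h2
  rw [map_mul, LinearMap.det_smul, map_one, mul_one] at this
  calc _ = (LinearMap.det (T i) * LinearMap.det (T i)) ^ 2 := by ring
    _ = 1 := by rw [this, ← pow_mul, mul_comm, pow_mul]; simp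

/-- Over a field where `q` is not a root of unity, `c₁ = c₂ = c₃ = 0` excludes `c₀ = ±2`. -/
theorem exists_ne_zero [FiniteDimensional F V] [Nontrivial V] (h : IsDAHASystem q c T S)
    (hq : ∀ n : ℕ, 0 < n → q ^ n ≠ 1) {k : F} (hkk : k * k = 1) (hc : c 0 = k + k) :
    ∃ i, i ≠ 0 ∧ c i ≠ 0 := by
  by_contra! hcon
  -- Nilpotency gives k - T₀ the characteristic polynomial Xⁿ with n = dim V; its value at k is det
  -- T₀ = kⁿ, whose fourth power is 1.
  have hnil : IsNilpotent (k • 1 - T 0) := ⟨2, by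
    rw [sq, mul_sub, sub_mul, sub_mul, h.sq_eq, hc]
    simp only [smul_mul_assoc, mul_smul_comm, one_mul, mul_one, smul_smul, hkk]
    module⟩
  have hdet0 : LinearMap.det (T 0) ^ 4 = 1 := by
    have hd := LinearMap.eval_charpoly (k • 1 - T 0) k
    rw [hnil.charpoly_eq_X_pow_finrank, Algebra.algebraMap_eq_smul_one, sub_sub_cancel,
      Polynomial.eval_pow, Polynomial.eval_X] at hd
    rw [← hd, ← pow_mul, mul_comm, pow_mul, show k ^ 4 = (k * k) ^ 2 by ring, hkk]
    simp
  -- The fourth power of the determinant of the product relation now reads 1 = q⁻⁴ⁿ, with n > 0.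
  have := congrArg (fun f => LinearMap.det f ^ 4) h.prod
  simp only [map_mul, mul_pow, LinearMap.det_smul, map_one, mul_one, hdet0,
    h.det_pow_four (hcon 1 (by decide)), h.det_pow_four (hcon 2 (by decide)),
    h.det_pow_four (hcon 3 (by decide))] at this
  rw [← pow_mul, inv_pow, eq_comm, inv_eq_one] at this
  exact hq _ (Nat.mul_pos Module.finrank_pos (by norm_num)) this

/-- Subspaces stable under the Askey--Wilson generators are stable under `T₀` unless
`c₁ = c₂ = c₃ = 0`. -/
theorem zero_apply_mem (h : IsDAHASystem q c T S) (hq0 : q ≠ 0)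
    (hq : ∀ n : ℕ, 0 < n → q ^ n ≠ 1) {i : Fin 4} (hi : i ≠ 0) (hci : c i ≠ 0)
    (P : Submodule F V) (hP : ∀ i, i ≠ 0 → ∀ v ∈ P, dahaX T S i v ∈ P) {v : V} (hv : v ∈ P) :
    T 0 v ∈ P := by
  have hqq : q - q⁻¹ ≠ 0 := fun h0 => by
    apply hq 2 (by norm_num)
    field_simp at h0
    linear_combination h0
  have key : ∀ a b d : Fin 4, a ≠ 0 → b ≠ 0 → d ≠ 0 → c a ≠ 0 →
      (q ^ 2 - q⁻¹ ^ 2) • dahaX T S a + (q • (dahaX T S b * dahaX T S d)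
      - q⁻¹ • (dahaX T S d * dahaX T S b))
      = (q - q⁻¹) • ((c b * c d) • 1 + c a • (q • S 0 + q⁻¹ • T 0)) → T 0 v ∈ P := by
    intro a b d ha hb hd hca e
    have e' := LinearMap.congr_fun e v
    have hm : (q ^ 2 - q⁻¹ ^ 2) • dahaX T S a v + (q • (dahaX T S b (dahaX T S d v))
      - q⁻¹ • (dahaX T S d (dahaX T S b v))) ∈ P :=
      P.add_mem (P.smul_mem _ (hP a ha v hv)) (P.sub_mem
        (P.smul_mem _ (hP b hb _ (hP d hd v hv))) (P.smul_mem _ (hP d hd _ (hP b hb v hv))))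
    simp only [LinearMap.add_apply, LinearMap.sub_apply, LinearMap.smul_apply,
      Module.End.mul_apply, Module.End.one_apply, h.inv_apply] at e'
    rw [e', P.smul_mem_iff hqq, P.add_mem_iff_right (P.smul_mem _ hv), P.smul_mem_iff hca] at hm
    -- Replacing T₀⁻¹ by c₀ - T₀ leaves T₀ with coefficient -(q - q⁻¹), nonzero because q² ≠ 1.
    have e2 : q • (c 0 • v - T 0 v) + q⁻¹ • T 0 v = (q * c 0) • v - (q - q⁻¹) • T 0 v := by module
    rw [e2, P.sub_mem_iff_right (P.smul_mem _ hv), P.smul_mem_iff hqq] at hm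
    exact hm
  fin_cases i
  · exact absurd rfl hi
  · exact key 1 3 2 (by decide) (by decide) (by decide) hci (h.relation_one hq0)
  · exact key 2 1 3 (by decide) (by decide) (by decide) hci (h.relation_two hq0)
  · exact key 3 2 1 (by decide) (by decide) (by decide) hci (h.relation_three hq0)

theorem eq_smul_one_of_complemented [FiniteDimensional F V] [Nontrivial V]
    (h : IsDAHASystem q c T S) (hq0 : q ≠ 0) (hq : ∀ n : ℕ, 0 < n → q ^ n ≠ 1)
    {k : F} (hkk : k * k = 1) (hc : c 0 = k + k)
    (hs : ∀ P : Submodule F V, (∀ i, i ≠ 0 → ∀ v ∈ P, dahaX T S i v ∈ P) →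
      ∃ Q : Submodule F V, (∀ i, i ≠ 0 → ∀ v ∈ Q, dahaX T S i v ∈ Q) ∧ IsCompl P Q) :
    T 0 = k • 1 := by
  obtain ⟨i, hi, hci⟩ := h.exists_ne_zero hq hkk hc
  obtain ⟨Q, hQ, hPQ⟩ := hs (Module.End.eigenspace (T 0) k) (by
    intro i _ v hv
    rw [Module.End.mem_eigenspace_iff] at hv ⊢
    have : T 0 (dahaX T S i v) = dahaX T S i (T 0 v) := LinearMap.congr_fun (h.commute_dahaX i) v
    rw [this, hv, map_smul])
  have hQ0 : Q ≤ Module.End.eigenspace (T 0) k := fun v hv => by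
    have hm : T 0 v - k • v ∈ Module.End.eigenspace (T 0) k :=
      Module.End.mem_eigenspace_iff.2 (h.sub_apply_sub_apply hkk hc v)
    have hm' : T 0 v - k • v ∈ Q :=
      Q.sub_mem (h.zero_apply_mem hq0 hq hi hci Q hQ hv) (Q.smul_mem _ hv)
    have := (Submodule.disjoint_def.1 hPQ.disjoint) _ hm hm'
    exact Module.End.mem_eigenspace_iff.2 (sub_eq_zero.1 this)
  have htop : Module.End.eigenspace (T 0) k = ⊤ := by
    rw [← hPQ.sup_eq_top, sup_eq_left.2 hQ0]
  ext v
  exact Module.End.mem_eigenspace_iff.1 (htop ▸ Submodule.mem_top : v ∈ _)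

theorem complemented_iff_isDiagonalizable [IsAlgClosed F] [FiniteDimensional F V] [Nontrivial V]
    (h : IsDAHASystem q c T S) (hq0 : q ≠ 0) (hq : ∀ n : ℕ, 0 < n → q ^ n ≠ 1)
    (irr : ∀ P : Submodule F V, (∀ i, ∀ v ∈ P, T i v ∈ P) → P = ⊥ ∨ P = ⊤) :
    (∀ P : Submodule F V, (∀ i, i ≠ 0 → ∀ v ∈ P, dahaX T S i v ∈ P) →
      ∃ Q : Submodule F V, (∀ i, i ≠ 0 → ∀ v ∈ Q, dahaX T S i v ∈ Q) ∧ IsCompl P Q) ↔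
      IsDiagonalizable (T 0) := by
  obtain ⟨k, k', hkk, hc⟩ := IsAlgClosed.exists_mul_eq_one_add_eq (c 0)
  by_cases hne : k = k'
  · subst hne
    constructor
    · intro hs
      have hT := h.eq_smul_one_of_complemented hq0 hq hkk hc hs
      exact isDiagonalizable_of_span _ fun v _ => Submodule.subset_span ⟨k, by rw [hT]; rfl⟩
    · intro hd P _
      have hT := h.eq_smul_one_of_isDiagonalizable hkk hc hd
      obtain ⟨Q, hQ⟩ := P.exists_isCompl
      refine ⟨Q, fun i _ v hv => ?_, hQ⟩
      rw [h.dahaX_of_eq_smul_one hc hT]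
      exact Q.smul_mem _ hv
  · exact ⟨fun _ => h.isDiagonalizable_of_ne hkk hc hne,
      fun _ => h.exists_isCompl_of_ne hq0 irr hkk hc hne⟩

end IsDAHASystem

/-! ### Passage between modules over the two algebras and stable subspaces. -/

namespace UniversalDAHA

theorem submodule_eq_bot_or_eq_top {F : Type*} [Field F] {q : F} {V : Type*} [AddCommGroup V]
    [Module F V] [Module (UniversalDAHA q) V] [IsSimpleModule (UniversalDAHA q) V] (P : Submodule F V)
    (hP : ∀ (x : UniversalDAHA q), ∀ v ∈ P, x • v ∈ P) : P = ⊥ ∨ P = ⊤ := by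
  let P' : Submodule (UniversalDAHA q) V := { P.toAddSubmonoid with smul_mem' := fun x v => hP x v }
  have hmem : ∀ v, v ∈ P ↔ v ∈ P' := fun v => Iff.rfl
  rcases eq_bot_or_eq_top P' with h | h
  · left; ext v; rw [hmem, h]; simp
  · right; ext v; rw [hmem, h]; simp

section Rep

variable {F : Type*} [Field F] {q : F} {V : Type*} [AddCommGroup V] [Module F V]
  [Module (UniversalDAHA q) V] [IsScalarTower F (UniversalDAHA q) V]

theorem smul_mem_of_t_mem {P : Submodule F V}
    (hT : ∀ i, ∀ v ∈ P, t q i • v ∈ P) (hS : ∀ i, ∀ v ∈ P, tInv q i • v ∈ P)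
    (x : UniversalDAHA q) : ∀ v ∈ P, x • v ∈ P := by
  obtain ⟨y, rfl⟩ := RingQuot.mkAlgHom_surjective F (DAHARel q) x
  induction y using FreeAlgebra.induction with
  | grade0 r =>
    intro v hv
    rw [AlgHom.commutes, algebraMap_smul]
    exact P.smul_mem _ hv
  | grade1 g =>
    cases g with
    | t i => exact hT i
    | tInv i => exact hS i
  | mul a b ha hb =>
    intro v hv
    rw [map_mul, mul_smul]
    exact ha _ (hb v hv)
  | add a b ha hb =>
    intro v hv
    rw [map_add, add_smul]
    exact P.add_mem (ha v hv) (hb v hv)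

/-- Schur's lemma for the central elements `t i + t i⁻¹`. -/
theorem exists_central_scalar [IsAlgClosed F] [FiniteDimensional F V]
    [IsSimpleModule (UniversalDAHA q) V] (i : Fin 4) :
    ∃ c : F, ∀ v : V, (t q i + tInv q i) • v = c • v := by
  have : Nontrivial V := IsSimpleModule.nontrivial (UniversalDAHA q) V
  obtain ⟨c, hc⟩ := Module.End.exists_eigenvalue (Algebra.lsmul F F V (t q i + tInv q i))
  refine ⟨c, fun v => ?_⟩
  have hmem : ∀ w, w ∈ Module.End.eigenspace (Algebra.lsmul F F V (t q i + tInv q i)) c ↔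
      (t q i + tInv q i) • w = c • w := fun w => Module.End.mem_eigenspace_iff
  rcases submodule_eq_bot_or_eq_top (q := q)
    (Module.End.eigenspace (Algebra.lsmul F F V (t q i + tInv q i)) c) (by
      intro x w hw
      rw [hmem] at hw ⊢
      rw [← mul_smul, central, mul_smul, hw, smul_algebra_smul_comm]) with h | h
  · exact absurd h hc
  · exact (hmem v).1 (h ▸ Submodule.mem_top)

theorem isDAHASystem {c : Fin 4 → F} (hc : ∀ i, ∀ v : V, (t q i + tInv q i) • v = c i • v) :
    IsDAHASystem q c (fun i => Algebra.lsmul F F V (t q i))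
      (fun i => Algebra.lsmul F F V (tInv q i)) where
  mul_inv i := by rw [← map_mul, t_mul_tInv, map_one]
  inv_mul i := by rw [← map_mul, tInv_mul_t, map_one]
  inv_eq i := by
    ext v
    have := hc i v
    rw [add_smul] at this
    simp [← this]
  prod := by
    rw [← map_mul, ← map_mul, ← map_mul, prod_t, AlgHom.commutes, Algebra.algebraMap_eq_smul_one]

/-- Semisimplicity of the pullback in terms of subspaces stable under the generators. -/
theorem isSemisimpleModule_pullback_iff (hq0 : q ≠ 0) (hq : ∀ n : ℕ, 0 < n → q ^ n ≠ 1) :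
    (letI : Module (UniversalAW q) V := pullbackModule q hq0 hq V;
      IsSemisimpleModule (UniversalAW q) V) ↔
    ∀ P : Submodule F V, (∀ g, ∀ v ∈ P, zetaGen q g • v ∈ P) →
      ∃ Q : Submodule F V, (∀ g, ∀ v ∈ Q, zetaGen q g • v ∈ Q) ∧ IsCompl P Q := by
  let _ : Module (UniversalAW q) V := pullbackModule q hq0 hq V
  have hsmul : ∀ (x : UniversalAW q) (v : V), x • v = zeta q hq0 hq x • v := fun _ _ => rfl
  -- The scalars of △_q act as those of F, so its submodules are exactly the F-subspaces stable
  -- under A, B, C.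
  have hscal : ∀ (r : F) (v : V), algebraMap F (UniversalAW q) r • v = r • v := fun r v => by
    rw [hsmul, AlgHom.commutes, algebraMap_smul]
  have hstab : ∀ P : Submodule F V, (∀ g, ∀ v ∈ P, zetaGen q g • v ∈ P) →
      ∀ x : UniversalAW q, ∀ v ∈ P, x • v ∈ P := by
    intro P hP x
    obtain ⟨y, rfl⟩ := RingQuot.mkAlgHom_surjective F (AWRel q) x
    induction y using FreeAlgebra.induction with
    | grade0 r =>
      intro v hv
      rw [AlgHom.commutes, hscal]
      exact P.smul_mem _ hv
    | grade1 g =>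
      intro v hv
      have := zeta_gen q hq0 hq g
      rw [UniversalAW.gen] at this
      rw [hsmul, this]
      exact hP g v hv
    | mul a b ha hb =>
      intro v hv
      rw [map_mul, mul_smul]
      exact ha _ (hb v hv)
    | add a b ha hb =>
      intro v hv
      rw [map_add, add_smul]
      exact P.add_mem (ha v hv) (hb v hv)
  let toF : Submodule (UniversalAW q) V → Submodule F V := fun P =>
    { P.toAddSubmonoid with
      smul_mem' := fun r v hv => by
        rw [← hscal]
        exact P.smul_mem _ hv }
  have htoF : ∀ P g, ∀ v ∈ toF P, zetaGen q g • v ∈ toF P := fun P g v hv => by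
    rw [← zeta_gen q hq0 hq, ← hsmul]
    exact P.smul_mem _ hv
  let ofF : ∀ P : Submodule F V, (∀ g, ∀ v ∈ P, zetaGen q g • v ∈ P) →
      Submodule (UniversalAW q) V := fun P hP =>
    { P.toAddSubmonoid with smul_mem' := fun x v => hstab P hP x v }
  rw [isSemisimpleModule_iff]
  constructor
  · intro hs P hP
    obtain ⟨Q, hQ⟩ := hs.exists_isCompl (ofF P hP)
    refine ⟨toF Q, htoF Q, ?_⟩
    rw [isCompl_iff, Submodule.disjoint_def, Submodule.codisjoint_iff_exists_add_eq] at hQ ⊢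
    exact hQ
  · intro hs
    refine ⟨fun P => ?_⟩
    obtain ⟨Q, hQs, hQ⟩ := hs (toF P) (htoF P)
    refine ⟨ofF Q hQs, ?_⟩
    rw [isCompl_iff, Submodule.disjoint_def, Submodule.codisjoint_iff_exists_add_eq] at hQ ⊢
    exact hQ

/-- The generators A, B, C correspond to the indices 1, 3, 2 in that order. -/
theorem zetaGen_stable_iff (P : Submodule F V) :
    (∀ g, ∀ v ∈ P, zetaGen q g • v ∈ P) ↔
      ∀ i, i ≠ 0 → ∀ v ∈ P, dahaX (fun i => Algebra.lsmul F F V (t q i))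
        (fun i => Algebra.lsmul F F V (tInv q i)) i v ∈ P := by
  have hX : ∀ (i : Fin 4) (v : V), dahaX (fun i => Algebra.lsmul F F V (t q i))
      (fun i => Algebra.lsmul F F V (tInv q i)) i v
      = (t q i * t q 0 + tInv q 0 * tInv q i) • v := fun i v => by
    simp only [dahaX, ← map_mul, ← map_add, Algebra.lsmul_coe]
  simp only [hX]
  constructor
  · intro h i hi
    fin_cases i
    · exact absurd rfl hi
    · exact h AWGen.A
    · exact h AWGen.C
    · exact h AWGen.B
  · intro h g
    cases g
    · exact h 1 (by decide)
    · exact h 3 (by decide)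
    · exact h 2 (by decide)

end Rep

end UniversalDAHA

theorem mainTheorem2 {F : Type*} [Field F] [IsAlgClosed F] (q : F) (hq0 : q ≠ 0)
    (hq : ∀ n : ℕ, 0 < n → q ^ n ≠ 1)
    (V : Type*) [AddCommGroup V] [Module F V] [Module (UniversalDAHA q) V]
    [IsScalarTower F (UniversalDAHA q) V] [FiniteDimensional F V]
    [IsSimpleModule (UniversalDAHA q) V] :
    (letI : Module (UniversalAW q) V := UniversalDAHA.pullbackModule q hq0 hq V;
      IsSemisimpleModule (UniversalAW q) V) ↔
      IsDiagonalizable (Algebra.lsmul F F V (UniversalDAHA.t q 0)) := by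
  have : Nontrivial V := IsSimpleModule.nontrivial (UniversalDAHA q) V
  choose c hc using UniversalDAHA.exists_central_scalar (F := F) (q := q) (V := V)
  have h := UniversalDAHA.isDAHASystem hc
  rw [UniversalDAHA.isSemisimpleModule_pullback_iff (F := F)]
  simp only [UniversalDAHA.zetaGen_stable_iff]
  refine h.complemented_iff_isDiagonalizable hq0 hq fun P hP =>
    UniversalDAHA.submodule_eq_bot_or_eq_top (q := q) P
      (UniversalDAHA.smul_mem_of_t_mem hP fun i v hv => ?_)
  -- Stability under t_i gives stability under t_i⁻¹ = c_i - t_i.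
  exact (h.inv_apply_mem_iff i hv).2 (hP i v hv)
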